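/- All groups are abelian. A Murley group is a reduced torsion-free group $G$ of finite rank such that, for every prime $p$, its $p$-rank $r_p(G)=\dim_{\mathbb{F}_p}(G/pG)$ is at most $1$. A multiplication on $G$ is a homomorphism $\mu\colon G\otimes_{\mathbb{Z}} G\to G$; it makes $G$ into a (not necessarily associative) ring, called a ring on $G$, which is trivial if $\mu=0$. A ring is nilpotent if for some $n\ge 1$ all products of $n$ of its elements, with any bracketing, are zero. For $g\in G$ and a prime $p$, the $p$-height $h_p(g)\in\mathbb{N}_0\cup\{\infty\}$ is the supremum of the integers $k\ge 0$ with $g\in p^kG$; two elements have the same type if their $p$-heights are equal for all but finitely many primes $p$, and are both finite whenever they differ. A group is homogeneous if all its non-zero elements have the same type. Groups $A$ and $B$ are quasi-isomorphic if there are subgroups $A'\subseteq A$ and $B'\subseteq B$ with $A'\cong B'$, $mA\subseteq A'$ and $nB\subseteq B'$ for some positive integers $m,n$. A torsion-free group is strongly indecomposable if it is not quasi-isomorphic to $A\oplus B$ for any non-zero torsion-free groups $A$ and $B$. **Theorem 8.** 1. On a Murley group, every multiplication is associative and commutative. 2. On a Murley group, every non-trivial ring is not nilpotent. 3. Every homogeneous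 Murley group is strongly indecomposable. -/

import Mathlib

open scoped TensorProduct

namespace Murley

/-! ### Torsion-free groups of finite rank, heights and types -/

/-- An abelian group is reduced if its only divisible subgroup is zero. -/
def IsReducedGroup (G : Type*) [AddCommGroup G] : Prop :=
  ∀ D : AddSubgroup G,
    (∀ n : ℕ, 0 < n → ∀ d ∈ D, ∃ d' ∈ D, n • d' = d) → D = ⊥

/-- The `p`-rank of `G`: the dimension of `G / pG` over the field with `p` elements. -/
noncomputable def pRank (p : ℕ) (G : Type*) [AddCommGroup G] : Cardinal :=
  Module.rank (ZMod p) (ModN G p)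

/-- A Murley group: a reduced torsion-free abelian group of finite rank whose `p`-rank is at
most one for every prime `p`. -/
structure IsMurleyGroup (G : Type*) [AddCommGroup G] : Prop where
  torsionFree : IsAddTorsionFree G
  finiteRank : Module.rank ℤ G < Cardinal.aleph0
  reduced : IsReducedGroup G
  pRank_le_one : ∀ p : ℕ, p.Prime → pRank p G ≤ 1

/-- The `p`-height of `g` in `G`: the supremum in `ℕ∞` of all `k` such that `p ^ k` divides `g`
in `G`. -/
noncomputable def height {G : Type*} [AddCommGroup G] (p : ℕ) (g : G) : ℕ∞ :=
  ⨆ (k : ℕ) (_ : ∃ x : G, p ^ k • x = g), (k : ℕ∞)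

/-- The characteristic of `g`: the sequence of its heights at all primes. -/
noncomputable def characteristic {G : Type*} [AddCommGroup G] (g : G) : Nat.Primes → ℕ∞ :=
  fun p => height (p : ℕ) g

/-- Two characteristics are equivalent if they differ at only finitely many primes, and both
are finite wherever they differ. -/
def charSetoid : Setoid (Nat.Primes → ℕ∞) where
  r χ ψ := {p | χ p ≠ ψ p}.Finite ∧ ∀ p, χ p ≠ ψ p → χ p ≠ ⊤ ∧ ψ p ≠ ⊤
  iseqv :=
    { refl := fun χ => by simp
      symm := fun {χ ψ} h =>
        ⟨h.1.subset fun p hp => Ne.symm hp, fun p hp => (h.2 p (Ne.symm hp)).symm⟩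
      trans := fun {χ ψ ω} h₁ h₂ => by
        refine ⟨(h₁.1.union h₂.1).subset fun p hp => ?_, fun p hp => ?_⟩
        · by_contra hc
          simp only [Set.mem_union, Set.mem_ofPred_eq, not_or, not_not] at hc
          exact hp (hc.1.trans hc.2)
        · by_cases e₁ : χ p = ψ p
          · have := h₂.2 p (fun e₂ => hp (e₁.trans e₂))
            exact ⟨e₁ ▸ this.1, this.2⟩
          · by_cases e₂ : ψ p = ω p
            · have := h₁.2 p e₁
              exact ⟨this.1, e₂ ▸ this.2⟩
            · exact ⟨(h₁.2 p e₁).1, (h₂.2 p e₂).2⟩ }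

/-- The type of `g`: the equivalence class of its characteristic. -/
noncomputable def typeOf {G : Type*} [AddCommGroup G] (g : G) : Quotient charSetoid :=
  Quotient.mk charSetoid (characteristic g)

/-- A group is homogeneous if all its non-zero elements have the same type. -/
def IsHomogeneous (G : Type*) [AddCommGroup G] : Prop :=
  ∀ g h : G, g ≠ 0 → h ≠ 0 → typeOf g = typeOf h

/-! ### Quasi-isomorphism and strong indecomposability -/

/-- Quasi-isomorphism of abelian groups. -/
def QuasiIsomorphic (A B : Type*) [AddCommGroup A] [AddCommGroup B] : Prop :=
  ∃ (A' : AddSubgroup A) (B' : AddSubgroup B),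
    Nonempty (A' ≃+ B') ∧
      ∃ m n : ℕ, 0 < m ∧ 0 < n ∧ (∀ a : A, m • a ∈ A') ∧ (∀ b : B, n • b ∈ B')

/-- `G` is strongly indecomposable if it is not quasi-isomorphic to a direct sum of two non-zero
torsion-free groups. Torsion-freeness of the summands has to be required, since otherwise
every non-zero group `G` would be quasi-isomorphic to `G ⊕ ℤ/2`. It is no restriction to take
the summands in the universe of `G`: if `G` is quasi-isomorphic to a torsion-free group `C`,
then multiplication by a positive integer embeds `C` into a group isomorphic to a subgroup
of `G`. -/
def IsStronglyIndecomposable.{u} (G : Type u) [AddCommGroup G] : Prop :=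
  ∀ (A B : Type u) [AddCommGroup A] [AddCommGroup B],
    IsAddTorsionFree A → IsAddTorsionFree B → Nontrivial A → Nontrivial B →
      ¬ QuasiIsomorphic G (A × B)

/-! ### Multiplications on a group -/

/-- A multiplication on `G`, that is, a (not necessarily associative) ring on `G`. -/
abbrev Multiplication (G : Type*) [AddCommGroup G] := G ⊗[ℤ] G →+ G

namespace Multiplication

variable {G : Type*} [AddCommGroup G]

/-- The product of two elements. -/
def prod (μ : Multiplication G) (a b : G) : G := μ (a ⊗ₜ[ℤ] b)

/-- Associativity of a multiplication. -/
def IsAssoc (μ : Multiplication G) : Prop :=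
  ∀ a b c : G, μ.prod (μ.prod a b) c = μ.prod a (μ.prod b c)

/-- Commutativity of a multiplication. -/
def IsComm (μ : Multiplication G) : Prop :=
  ∀ a b : G, μ.prod a b = μ.prod b a

/-- `IsProduct μ n g`: the element `g` is a product of `n ≥ 1` elements of `G`, with some
bracketing. -/
inductive IsProduct (μ : Multiplication G) : ℕ → G → Prop
  | single (a : G) : IsProduct μ 1 a
  | mul {m n : ℕ} {a b : G} (ha : IsProduct μ m a) (hb : IsProduct μ n b) :
      IsProduct μ (m + n) (μ.prod a b)

/-- A ring is nilpotent if, for some `n ≥ 1`, all products of `n` elements, bracketed in any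
way, are zero. -/
def IsNilpotentRing (μ : Multiplication G) : Prop :=
  ∃ n : ℕ, 0 < n ∧ ∀ g : G, IsProduct μ n g → g = 0

end Multiplication

end Murley

/-!
Elementary divisibility carries the whole theorem. If `G / pG` has dimension at most one over the
field with `p` elements, then some `e` satisfies `G = ℤe + pG`, and substituting this into itself
gives `G = ℤe + p ^ k G` for all `k` (`exists_sub_zsmul_mem`): every quotient `G / p ^ k G` is
cyclic, with a generator that does not depend on `k`. On the other hand, the elements divisible by
all prime powers form a divisible subgroup, so they vanish in a reduced group
(`eq_zero_of_forall_prime_pow`). Together these say that `G` embeds into a product of rings of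
`p`-adic integers, and the three parts are what remains of this embedding.

* A bilinear operation on a cyclic group is determined by `e * e` and is associative and
  commutative; hence so is a multiplication on `G` modulo every `p ^ k`, and thus on `G`.
* If a multiplication is non-zero, then it is non-zero modulo a power of some `p`, and so `e * e`
  has finite `p`-height for the corresponding `e`. Multiplication by `e` then preserves the
  property of having finite `p`-height (`prod_notMem`), so that products
  `e * (e * (⋯ * (e * x)))` of any length are non-zero as soon as `x` has finite `p`-height.
* Suppose that `G` is quasi-isomorphic to `A × B`, and let `a ∈ A` and `b ∈ B` be non-zero. Since
  `G / p ^ k G` is cyclic, the elements of `G` corresponding to multiples of `a` and `b` satisfy a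
  linear relation modulo `p ^ k` whose coefficients are not both divisible by `p`; read in
  `A × B` it shows that one of `a` and `b` has infinite `p`-height. If `G` is homogeneous, then
  both have, and this for every `p`, which is impossible in a reduced group.
-/

namespace Murley

/-! ### Divisibility in abelian groups -/

/-- The subgroup `nG` of multiples of `n` in `G`. -/
def multiples (G : Type*) [AddCommGroup G] (n : ℕ) : AddSubgroup G :=
  (nsmulAddMonoidHom (α := G) n).range

section Divisibility

variable {G : Type*} [AddCommGroup G]

theorem mem_multiples {n : ℕ} {x : G} : x ∈ multiples G n ↔ ∃ y : G, n • y = x := Iff.rfl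

theorem multiples_le_of_dvd {m n : ℕ} (h : m ∣ n) : multiples G n ≤ multiples G m := by
  rintro x ⟨y, rfl⟩
  obtain ⟨k, rfl⟩ := h
  exact ⟨k • y, (mul_nsmul' y m k).symm⟩

theorem map_mem_multiples {H : Type*} [AddCommGroup H] (f : G →+ H) {n : ℕ} {x : G}
    (hx : x ∈ multiples G n) : f x ∈ multiples H n := by
  obtain ⟨y, rfl⟩ := mem_multiples.1 hx
  exact ⟨f y, (map_nsmul f n y).symm⟩

theorem mem_multiples_of_isCoprime {c : ℤ} {n : ℕ} (h : IsCoprime c n) {x : G}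
    (hx : c • x ∈ multiples G n) : x ∈ multiples G n := by
  obtain ⟨u, v, huv⟩ := h
  have hnx : (n : ℤ) • x ∈ multiples G n := ⟨x, (natCast_zsmul x n).symm⟩
  have := add_mem ((multiples G n).zsmul_mem hx u) ((multiples G n).zsmul_mem hnx v)
  rwa [← mul_smul, ← mul_smul, ← add_smul, huv, one_smul] at this

/-- Multiplication by an integer not divisible by `p ^ i` raises the `p`-height by less
than `i`. -/
theorem mem_multiples_of_not_pow_dvd [IsAddTorsionFree G] {p : ℕ} (hp : p.Prime) {l : ℕ} {x : G}
    (i : ℕ) (c : ℤ) (hc : ¬ (p : ℤ) ^ i ∣ c) (hx : c • x ∈ multiples G (p ^ (i + l))) :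
    x ∈ multiples G (p ^ l) := by
  induction i generalizing c with
  | zero => simp at hc
  | succ i ih =>
    by_cases hpc : (p : ℤ) ∣ c
    · obtain ⟨d, rfl⟩ := hpc
      refine ih d (fun h => hc ?_) ?_
      · rw [pow_succ']
        exact mul_dvd_mul_left _ h
      · obtain ⟨y, hy⟩ := mem_multiples.1 hx
        refine ⟨y, nsmul_right_injective hp.ne_zero ?_⟩
        change p • p ^ (i + l) • y = p • d • x
        rw [← mul_nsmul', ← pow_succ', ← natCast_zsmul (d • x) p, ← mul_smul, ← hy]
        congr 2
        omega
    · have hcop : IsCoprime c ((p ^ (i + 1 + l) : ℕ) : ℤ) := by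
        push_cast
        exact (((Nat.prime_iff_prime_int.1 hp).coprime_iff_not_dvd.2 hpc).symm).pow_right
      exact multiples_le_of_dvd (pow_dvd_pow p (by omega)) (mem_multiples_of_isCoprime hcop hx)

theorem mem_multiples_of_forall_prime_pow {x : G}
    (hx : ∀ p : ℕ, p.Prime → ∀ k : ℕ, x ∈ multiples G (p ^ k)) {n : ℕ} (hn : 0 < n) :
    x ∈ multiples G n := by
  induction n using Nat.recOnPosPrimePosCoprime with
  | prime_pow p k hp _ => exact hx p hp k
  | zero => simp at hn
  | one => exact ⟨x, one_nsmul x⟩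
  | coprime a b ha hb hab iha ihb =>
    obtain ⟨y, hy⟩ := mem_multiples.1 (iha (by omega))
    obtain ⟨z, hz⟩ := mem_multiples.1 (ihb (by omega))
    obtain ⟨u, v, huv⟩ := Nat.isCoprime_iff_coprime.2 hab
    refine ⟨u • z + v • y, ?_⟩
    change (a * b) • (u • z + v • y) = x
    rw [← natCast_zsmul] at hy hz ⊢
    calc ((a * b : ℕ) : ℤ) • (u • z + v • y)
        = (u * a) • (b : ℤ) • z + (v * b) • (a : ℤ) • y := by push_cast; module
      _ = x := by rw [hy, hz, ← add_smul, huv, one_smul]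

/-- In a torsion-free group the elements divisible by all positive integers form a divisible
subgroup. -/
theorem eq_zero_of_forall_prime_pow [IsAddTorsionFree G] (hG : IsReducedGroup G) {x : G}
    (hx : ∀ p : ℕ, p.Prime → ∀ k : ℕ, x ∈ multiples G (p ^ k)) : x = 0 := by
  let D : AddSubgroup G := ⨅ n : {n : ℕ // 0 < n}, multiples G n
  have hD : D = ⊥ := by
    refine hG D fun n hn d hd => ?_
    simp only [D, AddSubgroup.mem_iInf, Subtype.forall] at hd ⊢
    obtain ⟨y, rfl⟩ := mem_multiples.1 (hd n hn)
    refine ⟨y, fun m hm => ?_, rfl⟩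
    obtain ⟨z, hz⟩ := mem_multiples.1 (hd (n * m) (Nat.mul_pos hn hm))
    refine ⟨z, nsmul_right_injective hn.ne' ?_⟩
    change n • m • z = n • y
    rwa [← mul_nsmul']
  have hxD : x ∈ D := by
    simp only [D, AddSubgroup.mem_iInf, Subtype.forall]
    exact fun n hn => mem_multiples_of_forall_prime_pow hx hn
  rwa [hD, AddSubgroup.mem_bot] at hxD

/-- If the `p`-rank is at most one, then the quotients `G / p ^ k G` are cyclic with a common
generator. -/
theorem exists_sub_zsmul_mem {p : ℕ} (hp : p.Prime) (h : pRank p G ≤ 1) :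
    ∃ e : G, ∀ (k : ℕ) (x : G), ∃ c : ℤ, x - c • e ∈ multiples G (p ^ k) := by
  have := Fact.mk hp
  obtain ⟨v, hv⟩ := rank_le_one_iff.1 h
  obtain ⟨e, rfl⟩ := Submodule.mkQ_surjective _ v
  have key : ∀ x : G, ∃ (c : ℤ) (y : G), x = c • e + p • y := by
    intro x
    obtain ⟨r, hr⟩ := hv (Submodule.mkQ _ x)
    obtain ⟨c, rfl⟩ := ZMod.intCast_surjective r
    rw [Int.cast_smul_eq_zsmul, ← map_zsmul, eq_comm, ← sub_eq_zero, ← map_sub] at hr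
    obtain ⟨y, hy⟩ := (Submodule.Quotient.mk_eq_zero _).1 hr
    refine ⟨c, y, ?_⟩
    have hy' : (p : ℤ) • y = x - c • e := by simpa using hy
    rw [← natCast_zsmul, hy']
    abel
  refine ⟨e, fun k => ?_⟩
  induction k with
  | zero => exact fun x => ⟨0, x, by simp⟩
  | succ k ih =>
    intro x
    obtain ⟨c, hc⟩ := ih x
    obtain ⟨y, hy⟩ := mem_multiples.1 hc
    obtain ⟨d, z, rfl⟩ := key y
    refine ⟨c + p ^ k * d, z, ?_⟩
    change p ^ (k + 1) • z = _
    rw [add_smul, ← sub_sub, ← hy, smul_add, ← mul_nsmul', ← pow_succ, ← natCast_zsmul (d • e),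
      ← mul_smul]
    push_cast
    abel

theorem height_eq_top_iff {p : ℕ} {g : G} :
    height p g = ⊤ ↔ ∀ k : ℕ, g ∈ multiples G (p ^ k) := by
  constructor
  · intro h k
    have hk : (k : ℕ∞) < height p g := h ▸ ENat.natCast_lt_top k
    simp only [height, lt_iSup_iff] at hk
    obtain ⟨j, hj, hkj⟩ := hk
    exact multiples_le_of_dvd (pow_dvd_pow p (by exact_mod_cast hkj.le)) hj
  · intro h
    refine ENat.eq_top_iff_forall_ge.2 fun k => ?_
    exact le_iSup₂_of_le k (h k) le_rfl

/-- Equality of types preserves infinite heights at each single prime, since characteristics of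
the same type may differ only where both are finite. -/
theorem height_eq_top_of_typeOf_eq {g h : G} (hgh : typeOf g = typeOf h) {p : ℕ} (hp : p.Prime)
    (hg : height p g = ⊤) : height p h = ⊤ := by
  by_contra hh
  have : characteristic g ⟨p, hp⟩ ≠ characteristic h ⟨p, hp⟩ := fun e => hh (e.symm.trans hg)
  exact ((Quotient.exact hgh).2 _ this).1 hg

end Divisibility

/-! ### Multiplications -/

namespace Multiplication

variable {G : Type*} [AddCommGroup G] (μ : Multiplication G)

/-- A multiplication as a biadditive map. -/
def toBihom : G →+ G →+ G :=
  AddMonoidHom.mk' (fun a => AddMonoidHom.mk' (fun b => μ.prod a b)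
    fun b c => by simp [prod, TensorProduct.tmul_add])
    fun a b => by ext c; simp [prod, TensorProduct.add_tmul]

theorem toBihom_apply (a b : G) : μ.toBihom a b = μ.prod a b := rfl

theorem prod_sub_zsmul_mem {n : ℕ} {e a b : G} {s t : ℤ} (ha : a - s • e ∈ multiples G n)
    (hb : b - t • e ∈ multiples G n) :
    μ.prod a b - (s * t) • μ.prod e e ∈ multiples G n := by
  have h : μ.prod a b - (s * t) • μ.prod e e =
      μ.toBihom.flip b (a - s • e) + s • μ.toBihom e (b - t • e) := by
    simp only [← toBihom_apply, map_sub, map_zsmul, AddMonoidHom.flip_apply, mul_smul, smul_sub]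
    abel
  rw [h]
  exact add_mem (map_mem_multiples _ ha) (zsmul_mem (map_mem_multiples _ hb) s)

/-- Modulo `n`, a multiplication on a group with `G / nG` generated by `e` is
`(s • e) * (t • e) = (s * t * r) • e`, where `e * e = r • e`. -/
theorem prod_sub_zsmul_generator_mem {n : ℕ} {e a b : G} {r s t : ℤ}
    (he : μ.prod e e - r • e ∈ multiples G n) (ha : a - s • e ∈ multiples G n)
    (hb : b - t • e ∈ multiples G n) :
    μ.prod a b - (s * t * r) • e ∈ multiples G n := by
  have := add_mem (μ.prod_sub_zsmul_mem ha hb) (zsmul_mem he (s * t))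
  rwa [smul_sub, ← mul_smul, sub_add_sub_cancel] at this

theorem isAssoc_and_isComm (hG : IsMurleyGroup G) : μ.IsAssoc ∧ μ.IsComm := by
  have := hG.torsionFree
  constructor
  · intro a b c
    refine sub_eq_zero.1 (eq_zero_of_forall_prime_pow hG.reduced fun p hp k => ?_)
    obtain ⟨e, he⟩ := exists_sub_zsmul_mem hp (hG.pRank_le_one p hp)
    obtain ⟨r, hr⟩ := he k (μ.prod e e)
    obtain ⟨s, hs⟩ := he k a
    obtain ⟨t, ht⟩ := he k b
    obtain ⟨u, hu⟩ := he k c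
    have h₁ := μ.prod_sub_zsmul_mem (μ.prod_sub_zsmul_generator_mem hr hs ht) hu
    have h₂ := μ.prod_sub_zsmul_mem hs (μ.prod_sub_zsmul_generator_mem hr ht hu)
    have h := sub_mem h₁ h₂
    rwa [show s * (t * u * r) = s * t * r * u by ring, sub_sub_sub_cancel_right] at h
  · intro a b
    refine sub_eq_zero.1 (eq_zero_of_forall_prime_pow hG.reduced fun p hp k => ?_)
    obtain ⟨e, he⟩ := exists_sub_zsmul_mem hp (hG.pRank_le_one p hp)
    obtain ⟨s, hs⟩ := he k a
    obtain ⟨t, ht⟩ := he k b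
    have h := sub_mem (μ.prod_sub_zsmul_mem hs ht) (μ.prod_sub_zsmul_mem ht hs)
    rwa [mul_comm t s, sub_sub_sub_cancel_right] at h

/-- If `e` generates the quotients `G / p ^ k G` and `e * e` has finite `p`-height, then
multiplication by `e` preserves finiteness of the `p`-height. -/
theorem prod_notMem [IsAddTorsionFree G] {p : ℕ} (hp : p.Prime) {e : G}
    (he : ∀ (k : ℕ) (x : G), ∃ c : ℤ, x - c • e ∈ multiples G (p ^ k)) {l : ℕ}
    (hl : μ.prod e e ∉ multiples G (p ^ l)) {i : ℕ} {x : G} (hx : x ∉ multiples G (p ^ i)) :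
    μ.prod e x ∉ multiples G (p ^ (i + l)) := by
  intro h
  obtain ⟨c, hc⟩ := he (i + l) x
  refine hl (mem_multiples_of_not_pow_dvd hp i c ?_ ?_)
  · rintro ⟨d, rfl⟩
    refine hx ?_
    have h₁ := multiples_le_of_dvd (pow_dvd_pow p (Nat.le_add_right i l)) hc
    have h₂ : ((p : ℤ) ^ i * d) • e ∈ multiples G (p ^ i) :=
      ⟨d • e, by
        change p ^ i • d • e = _
        rw [mul_smul, ← Nat.cast_pow, natCast_zsmul]⟩
    simpa using add_mem h₁ h₂
  · have h₁ := μ.prod_sub_zsmul_mem (n := p ^ (i + l)) (s := 1) (a := e) (by simp) hc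
    rw [one_mul] at h₁
    simpa using sub_mem h h₁

theorem not_isNilpotentRing (hG : IsMurleyGroup G) (hμ : μ ≠ 0) : ¬ μ.IsNilpotentRing := by
  have := hG.torsionFree
  obtain ⟨a, b, hab⟩ : ∃ a b : G, μ.prod a b ≠ 0 := by
    by_contra! h
    exact hμ (AddMonoidHom.toIntLinearMap_injective (TensorProduct.ext' h))
  obtain ⟨p, hp, l, hl⟩ : ∃ p : ℕ, p.Prime ∧ ∃ l : ℕ, μ.prod a b ∉ multiples G (p ^ l) := by
    by_contra! h
    exact hab (eq_zero_of_forall_prime_pow hG.reduced h)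
  obtain ⟨e, he⟩ := exists_sub_zsmul_mem hp (hG.pRank_le_one p hp)
  have hee : μ.prod e e ∉ multiples G (p ^ l) := by
    intro h
    obtain ⟨s, hs⟩ := he l a
    obtain ⟨t, ht⟩ := he l b
    refine hl ?_
    simpa using add_mem (μ.prod_sub_zsmul_mem hs ht) (zsmul_mem h (s * t))
  have key : ∀ n : ℕ, ∃ x : G, μ.IsProduct (n + 1) x ∧ ∃ i : ℕ, x ∉ multiples G (p ^ i) := by
    intro n
    induction n with
    | zero => exact ⟨_, .single _, l, hl⟩
    | succ n ih =>
      obtain ⟨x, hx, i, hi⟩ := ih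
      exact ⟨μ.prod e x, add_comm 1 (n + 1) ▸ .mul (.single e) hx, _, μ.prod_notMem hp he hee hi⟩
  rintro ⟨n, hn, h⟩
  obtain ⟨x, hx, i, hi⟩ := key (n - 1)
  rw [Nat.sub_add_cancel hn] at hx
  exact hi (h x hx ▸ zero_mem _)

end Multiplication

/-! ### Strong indecomposability -/

section Indecomposable

variable {G : Type*} [AddCommGroup G]

/-- A linear relation between two elements of a cyclic group `G / nG` whose coefficients have no
common prime divisor. -/
theorem exists_isCoprime_add_mem {n : ℕ} {e : G}
    (he : ∀ x : G, ∃ c : ℤ, x - c • e ∈ multiples G n) (g h : G) :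
    ∃ c d : ℤ, IsCoprime c d ∧ c • g + d • h ∈ multiples G n := by
  obtain ⟨s, hs⟩ := he g
  obtain ⟨t, ht⟩ := he h
  obtain ⟨c, d, hcd, h0⟩ : ∃ c d : ℤ, IsCoprime c d ∧ c * s + d * t = 0 := by
    rcases eq_or_ne s 0 with rfl | hs0
    · exact ⟨1, 0, isCoprime_one_left, by simp⟩
    · obtain ⟨s', t', hst, h₁, h₂⟩ :=
        Int.exists_gcd_one (Int.gcd_pos_of_ne_zero_left t hs0)
      refine ⟨t', -s', (Int.isCoprime_iff_gcd_eq_one.2 hst).symm.neg_right, ?_⟩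
      linear_combination t' * h₁ - s' * h₂
  refine ⟨c, d, hcd, ?_⟩
  have h₁ := add_mem (zsmul_mem hs c) (zsmul_mem ht d)
  rwa [smul_sub, smul_sub, ← mul_smul, ← mul_smul, sub_add_sub_comm, ← add_smul, h0, zero_smul,
    sub_zero] at h₁

/-- A relation between `g` and `h` modulo a high power of `p`, not all of whose coefficients are
divisible by `p`, is mapped by `f` to one relation for `N • a` alone and one for `N • b` alone. -/
theorem forall_mem_multiples_or {A B : Type*} [AddCommGroup A] [AddCommGroup B]
    [IsAddTorsionFree A] [IsAddTorsionFree B] {p : ℕ} (hp : p.Prime) {e : G}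
    (he : ∀ (k : ℕ) (x : G), ∃ c : ℤ, x - c • e ∈ multiples G (p ^ k)) (f : G →+ A × B)
    {N : ℕ} (hN : N ≠ 0) {g h : G} {a : A} {b : B} (hg : f g = (N • a, 0))
    (hh : f h = (0, N • b)) :
    (∀ k : ℕ, a ∈ multiples A (p ^ k)) ∨ ∀ k : ℕ, b ∈ multiples B (p ^ k) := by
  have key : ∀ k : ℕ, a ∈ multiples A (p ^ k) ∨ b ∈ multiples B (p ^ k) := by
    intro k
    obtain ⟨c, d, hcd, hmem⟩ := exists_isCoprime_add_mem (he (1 + (N + k))) g h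
    -- Dividing by `N` costs at most `N` powers of `p`, since `N < p ^ N`.
    have hNp : ¬ (p : ℤ) ^ N ∣ N := by
      intro hdvd
      have hdvd' : p ^ N ∣ N := by exact_mod_cast hdvd
      exact (Nat.lt_pow_self hp.one_lt).not_ge (Nat.le_of_dvd (Nat.pos_of_ne_zero hN) hdvd')
    have hf := map_mem_multiples f hmem
    have ha : c • N • a ∈ multiples A (p ^ (1 + (N + k))) := by
      simpa [hg, hh] using map_mem_multiples (AddMonoidHom.fst A B) hf
    have hb : d • N • b ∈ multiples B (p ^ (1 + (N + k))) := by
      simpa [hg, hh] using map_mem_multiples (AddMonoidHom.snd A B) hf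
    by_cases hc : (p : ℤ) ∣ c
    · have hd : ¬ (p : ℤ) ∣ d := fun hd =>
        (Nat.prime_iff_prime_int.1 hp).not_isUnit (hcd.isUnit_of_dvd' hc hd)
      right
      have := mem_multiples_of_not_pow_dvd hp 1 d (by simpa using hd) hb
      exact mem_multiples_of_not_pow_dvd hp N N hNp (by rwa [natCast_zsmul])
    · left
      have := mem_multiples_of_not_pow_dvd hp 1 c (by simpa using hc) ha
      exact mem_multiples_of_not_pow_dvd hp N N hNp (by rwa [natCast_zsmul])
  by_contra! hcon
  obtain ⟨⟨i, hi⟩, j, hj⟩ := hcon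
  rcases key (max i j) with h | h
  · exact hi (multiples_le_of_dvd (pow_dvd_pow p (le_max_left i j)) h)
  · exact hj (multiples_le_of_dvd (pow_dvd_pow p (le_max_right i j)) h)

theorem isStronglyIndecomposable_of_isHomogeneous (hG : IsMurleyGroup G)
    (hom : IsHomogeneous G) : IsStronglyIndecomposable G := by
  intro A B _ _ _ _ _ _ ⟨G', C, ⟨φ⟩, m, n, hm, hn, hmG, hnC⟩
  have := hG.torsionFree
  obtain ⟨a, ha⟩ := exists_ne (0 : A)
  obtain ⟨b, hb⟩ := exists_ne (0 : B)
  -- After multiplication by `m` or `n`, `φ` and its inverse are defined on the whole groups.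
  let f : G →+ A × B :=
    C.subtype.comp (φ.toAddMonoidHom.comp ((nsmulAddMonoidHom m).codRestrict G' hmG))
  let ψ : A × B →+ G :=
    G'.subtype.comp (φ.symm.toAddMonoidHom.comp ((nsmulAddMonoidHom n).codRestrict C hnC))
  have hfψ : ∀ x : A × B, f (ψ x) = (m * n) • x := by
    intro x
    have h₁ : (nsmulAddMonoidHom m).codRestrict G' hmG (ψ x) =
        m • φ.symm ((nsmulAddMonoidHom n).codRestrict C hnC x) := rfl
    change ((φ ((nsmulAddMonoidHom m).codRestrict G' hmG (ψ x)) : C) : A × B) = _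
    rw [h₁, map_nsmul, AddEquiv.apply_symm_apply, mul_nsmul']
    rfl
  have hψ : ∀ x : A × B, x ≠ 0 → ψ x ≠ 0 := by
    intro x hx h0
    have h := hfψ x
    rw [h0, map_zero, eq_comm] at h
    exact hx ((nsmul_eq_zero_iff.1 h).resolve_right (Nat.mul_pos hm hn).ne')
  have hg0 : ψ (a, 0) ≠ 0 := hψ _ (by simpa using ha)
  have hh0 : ψ (0, b) ≠ 0 := hψ _ (by simpa using hb)
  refine hg0 (eq_zero_of_forall_prime_pow hG.reduced fun p hp => height_eq_top_iff.1 ?_)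
  obtain ⟨e, he⟩ := exists_sub_zsmul_mem hp (hG.pRank_le_one p hp)
  rcases forall_mem_multiples_or hp he f (Nat.mul_pos hm hn).ne' (a := a) (b := b)
    (by simpa using hfψ (a, 0)) (by simpa using hfψ (0, b)) with h | h
  · exact height_eq_top_iff.2 fun k =>
      map_mem_multiples (ψ.comp (AddMonoidHom.inl A B)) (h k)
  · exact height_eq_top_of_typeOf_eq (hom _ _ hh0 hg0) hp <| height_eq_top_iff.2 fun k =>
      map_mem_multiples (ψ.comp (AddMonoidHom.inr A B)) (h k)

end Indecomposable

end Murley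

theorem theorem8 {G : Type*} [AddCommGroup G] (hG : Murley.IsMurleyGroup G) :
    (∀ μ : Murley.Multiplication G, μ.IsAssoc ∧ μ.IsComm) ∧
    (∀ μ : Murley.Multiplication G, μ ≠ 0 → ¬ μ.IsNilpotentRing) ∧
    (Murley.IsHomogeneous G → Murley.IsStronglyIndecomposable G) :=
  ⟨fun μ => μ.isAssoc_and_isComm hG, fun μ => μ.not_isNilpotentRing hG,
    Murley.isStronglyIndecomposable_of_isHomogeneous hG⟩
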